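/- Let $\mathbb{G}=(\mathbb{R}^n,\star)$ be a stratified Lie group with neutral element $0$, with dilations $\delta_\lambda(x)=(\lambda^{\sigma_1}x_1,\dots,\lambda^{\sigma_n}x_n)$ ($\lambda>0$, integers $1\le\sigma_1\le\dots\le\sigma_n$) that are group automorphisms, and with homogeneous dimension $Q=\sum_{i=1}^n\sigma_i>2$. Let $X_1,\dots,X_m$ be a basis of the first stratum, i.e. of the space of left-invariant vector fields that are $\delta_\lambda$-homogeneous of degree $1$ (these generate the Lie algebra of $\mathbb{G}$), and put $\Delta_{\mathbb{G}}=\sum_{k=1}^m X_k^2$ and $\mathbb{G}^*=\mathbb{G}\setminus\{0\}$. Let $p=\frac{Q}{Q-2}$, let $u_0,f\in L^1_{loc}(\mathbb{G})$ be real-valued with $u_0\ge 0$ almost everywhere, and suppose that $\int_{\mathbb{G}^*}f\,dx>0$ (the integral with respect to Lebesgue measure exists in $(0,+\infty]$; the non-negativity of $f$ is not needed). Then the problem $$u_t-\Delta_{\mathbb{G}}u=|u|^p+f(x)\ \text{ in }(0,\infty)\times\mathbb{G},\qquad u(0,x)=u_0(x),$$ has no global in time weak solution. That is, there is no real-valued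 $u\in L^p_{loc}((0,\infty),L^p_{loc}(\mathbb{G}))$ such that, for every compactly supported $\psi\in C^1([0,\infty);C^2_c(\mathbb{G}^*))$ with $\psi\ge0$, the function $|u|^p\psi$ is integrable over $(0,\infty)\times\mathbb{G}^*$ and $$\int_0^\infty\!\!\int_{\mathbb{G}^*}|u|^p\psi+\int_{\mathbb{G}^*}u_0\,\psi(0,x)+\int_0^\infty\!\!\int_{\mathbb{G}^*}f\psi+\int_0^\infty\!\!\int_{\mathbb{G}^*}u\,\psi_t+\int_0^\infty\!\!\int_{\mathbb{G}^*}u\,\Delta_{\mathbb{G}}\psi=0.$$ The same holds with the opposite sign convention $\Delta_{\mathbb{G}}=-\sum_{k=1}^m X_k^2$. -/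

import Mathlib

open Set MeasureTheory
open scoped ContDiff

noncomputable section

namespace Stratified

/-- A Lie group `(ℝⁿ, ⋆)` with neutral element `0`, together with integers
`1 ≤ σ₁ ≤ ⋯ ≤ σₙ` such that the dilations `δ_l x = (l ^ σ₁ x₁, …, l ^ σₙ xₙ)`, `l > 0`,
are group automorphisms. -/
structure HomogeneousGroup (n : ℕ) where
  mul : (Fin n → ℝ) → (Fin n → ℝ) → (Fin n → ℝ)
  inv : (Fin n → ℝ) → (Fin n → ℝ)
  mul_assoc : ∀ x y z, mul (mul x y) z = mul x (mul y z)
  zero_mul : ∀ x, mul 0 x = x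
  mul_zero : ∀ x, mul x 0 = x
  inv_mul : ∀ x, mul (inv x) x = 0
  contDiff_mul : ContDiff ℝ ∞ (fun z : (Fin n → ℝ) × (Fin n → ℝ) => mul z.1 z.2)
  contDiff_inv : ContDiff ℝ ∞ inv
  σ : Fin n → ℕ
  one_le_σ : ∀ i, 1 ≤ σ i
  monotone_σ : Monotone σ
  dil_mul : ∀ l : ℝ, 0 < l → ∀ x y,
    (fun i => l ^ σ i * mul x y i) = mul (fun i => l ^ σ i * x i) (fun i => l ^ σ i * y i)

namespace HomogeneousGroup

variable {n : ℕ} (G : HomogeneousGroup n)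

/-- The dilation `δ_l`. It is a linear map, hence equal to its own differential. -/
def dil (l : ℝ) (x : Fin n → ℝ) : Fin n → ℝ := fun i => l ^ G.σ i * x i

/-- The homogeneous dimension `Q = σ₁ + ⋯ + σₙ`. -/
def homDim : ℕ := ∑ i, G.σ i

/-- The Lie algebra of the group: the vector fields `X` on `ℝⁿ` that are invariant under all
left translations `L_a x = a ⋆ x`, that is `X (a ⋆ x) = dL_a(x) (X x)`. -/
def leftInvariant : Submodule ℝ ((Fin n → ℝ) → (Fin n → ℝ)) where
  carrier := {X | ∀ a x, X (G.mul a x) = fderiv ℝ (G.mul a) x (X x)}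
  zero_mem' := by intro a x; simp
  add_mem' := by
    intro X Y hX hY a x
    simp only [Pi.add_apply, map_add]
    rw [hX a x, hY a x]
  smul_mem' := by
    intro c X hX a x
    simp only [Pi.smul_apply, map_smul]
    rw [hX a x]

/-- The first stratum: the left-invariant vector fields that are `δ_l`-homogeneous of degree one,
`X (φ ∘ δ_l) = l • (X φ) ∘ δ_l` for all smooth `φ`, that is `dδ_l (X x) = l • X (δ_l x)`. -/
def firstStratum : Submodule ℝ ((Fin n → ℝ) → (Fin n → ℝ)) where
  carrier := {X | X ∈ G.leftInvariant ∧
    ∀ l : ℝ, 0 < l → ∀ x, G.dil l (X x) = l • X (G.dil l x)}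
  zero_mem' := by
    refine ⟨zero_mem _, fun l _ x => ?_⟩
    ext i
    simp [dil]
  add_mem' := by
    rintro X Y ⟨hX, hX'⟩ ⟨hY, hY'⟩
    refine ⟨add_mem hX hY, fun l hl x => ?_⟩
    rw [Pi.add_apply, Pi.add_apply, smul_add, ← hX' l hl x, ← hY' l hl x]
    ext i
    simp [dil, mul_add]
  smul_mem' := by
    rintro c X ⟨hX, hX'⟩
    refine ⟨Submodule.smul_mem _ c hX, fun l hl x => ?_⟩
    rw [Pi.smul_apply, Pi.smul_apply, smul_comm, ← hX' l hl x]
    ext i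
    simp [dil, mul_left_comm]

end HomogeneousGroup

/-- A stratified Lie group `𝔾 = (ℝⁿ, ⋆)`: the first stratum generates the Lie algebra, that is
every space of vector fields that contains the first stratum and is closed under Lie brackets
contains all left-invariant vector fields. -/
structure StratifiedGroup (n : ℕ) extends HomogeneousGroup n where
  generates : ∀ W : Submodule ℝ ((Fin n → ℝ) → (Fin n → ℝ)),
    toHomogeneousGroup.firstStratum ≤ W →
    (∀ X ∈ W, ∀ Y ∈ W, VectorField.lieBracket ℝ X Y ∈ W) →
    toHomogeneousGroup.leftInvariant ≤ W

/-- The action of a vector field on functions, `(X φ)(x) = dφ(x) (X x)`. -/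
def applyField {n : ℕ} (X : (Fin n → ℝ) → (Fin n → ℝ)) (φ : (Fin n → ℝ) → ℝ) :
    (Fin n → ℝ) → ℝ := fun x => fderiv ℝ φ x (X x)

/-- The sub-Laplacian `X₁² + ⋯ + X_m²` of a basis `X₁, …, X_m` of the first stratum. -/
def subLaplacian {n m : ℕ} (G : StratifiedGroup n)
    (X : Module.Basis (Fin m) ℝ G.firstStratum) (φ : (Fin n → ℝ) → ℝ) : (Fin n → ℝ) → ℝ :=
  fun x => ∑ k, applyField (X k : (Fin n → ℝ) → (Fin n → ℝ))
    (applyField (X k : (Fin n → ℝ) → (Fin n → ℝ)) φ) x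

/-- Test functions on `[0, ∞) × (ℝⁿ ∖ {0})`: `t ↦ ψ t` is a `C¹` map with values in
`C²_c(ℝⁿ ∖ {0})` (that is, `ψ`, `ψ_t` and their `x`-derivatives of order at most two are jointly
continuous), with compact support in time and space, and `ψ t x ≥ 0` for `t ≥ 0`; `ψ` need not
vanish at `t = 0`. A test function on `[0, ∞)` is given by an extension of it to negative times,
which always exists and is never used. -/
structure IsTestFunction {n : ℕ} (ψ : ℝ → (Fin n → ℝ) → ℝ) : Prop where
  nonneg : ∀ t, 0 ≤ t → ∀ x, 0 ≤ ψ t x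
  hasCompactSupport : HasCompactSupport (fun z : ℝ × (Fin n → ℝ) => ψ z.1 z.2)
  tsupport_subset : tsupport (fun z : ℝ × (Fin n → ℝ) => ψ z.1 z.2) ⊆ univ ×ˢ {0}ᶜ
  contDiff : ∀ t, ContDiff ℝ 2 (ψ t)
  continuous : ∀ k ≤ 2, Continuous (fun z : ℝ × (Fin n → ℝ) => iteratedFDeriv ℝ k (ψ z.1) z.2)
  differentiable : ∀ x, Differentiable ℝ (fun t => ψ t x)
  contDiff_deriv : ∀ t, ContDiff ℝ 2 (fun x => deriv (fun s => ψ s x) t)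
  continuous_deriv : ∀ k ≤ 2, Continuous (fun z : ℝ × (Fin n → ℝ) =>
    iteratedFDeriv ℝ k (fun x => deriv (fun s => ψ s x) z.1) z.2)

/-- `u` is a global in time weak solution of `u_t - L u = |u| ^ p + f`, `u(0, ·) = u₀`
(for a formally self-adjoint differential operator `L` in `x`): `u` is in
`L^p_loc((0, ∞); L^p_loc(ℝⁿ))` and satisfies the weak equation for all test functions.
That equation presupposes that `|u| ^ p ψ` is integrable, also up to `t = 0`; the integrability of
the other terms then follows for `p ≥ 1` and locally integrable `f` and `u₀`. -/
structure IsGlobalWeakSolution {n : ℕ} (L : ((Fin n → ℝ) → ℝ) → (Fin n → ℝ) → ℝ) (p : ℝ)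
    (f u₀ : (Fin n → ℝ) → ℝ) (u : ℝ → (Fin n → ℝ) → ℝ) : Prop where
  memLp_loc : ∀ K : Set (ℝ × (Fin n → ℝ)), IsCompact K → K ⊆ Ioi 0 ×ˢ univ →
    MemLp (fun z : ℝ × (Fin n → ℝ) => u z.1 z.2) (ENNReal.ofReal p) (volume.restrict K)
  integrable : ∀ ψ, IsTestFunction ψ → IntegrableOn
    (fun z : ℝ × (Fin n → ℝ) => |u z.1 z.2| ^ p * ψ z.1 z.2) (Ioi 0 ×ˢ {0}ᶜ)
  weak_eq : ∀ ψ, IsTestFunction ψ →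
    (∫ z in Ioi (0 : ℝ) ×ˢ ({0}ᶜ : Set (Fin n → ℝ)), |u z.1 z.2| ^ p * ψ z.1 z.2)
      + (∫ x in ({0}ᶜ : Set (Fin n → ℝ)), u₀ x * ψ 0 x)
      + (∫ z in Ioi (0 : ℝ) ×ˢ ({0}ᶜ : Set (Fin n → ℝ)), f z.2 * ψ z.1 z.2)
      + (∫ z in Ioi (0 : ℝ) ×ˢ ({0}ᶜ : Set (Fin n → ℝ)),
          u z.1 z.2 * deriv (fun s => ψ s z.2) z.1)
      + (∫ z in Ioi (0 : ℝ) ×ˢ ({0}ᶜ : Set (Fin n → ℝ)), u z.1 z.2 * L (ψ z.1) z.2) = 0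

end Stratified

end

/-!
The proof is the test function method with a cutoff adapted to the critical exponent. Let `N` be
the polynomial `gauge`, homogeneous of some degree `d` under the dilations and positive off `0`, so
that `r = N ^ (1 / d)` is a homogeneous norm. The weak equation is tested with
`ψ(t, x) = b (t / T) b (log N(x) / L)`, where `b` is a power of a bump function, chosen so that
`|b'|, |b''| ≤ C b ^ (1 / p)` (`exists_cutoff`). The spatial factor is supported away from `0` and
equals `1` on an annulus that exhausts `𝔾 ∖ {0}` as `L → ∞`.

A field `X` of the first stratum is smooth and lowers the degree of homogeneity by one, so
`|X N| ≤ C r ^ (d - 1)` and `|X² N| ≤ C r ^ (d - 2)` by compactness of the unit sphere. By the chain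
rule, `|Δ ψ| ≤ (C / L) ψ ^ (1 / p) r ^ (-2)` (`exists_bound_subLaplacian`), and
`|∂ₜ ψ| ≤ (C / T) ψ ^ (1 / p)`. Young's inequality then absorbs the terms with `u ∂ₜ ψ` and `u Δ ψ`
into `|u| ^ p ψ` (`abs_setIntegral_le`). The conjugate exponent of `p = Q / (Q - 2)` is `Q / 2`, so
what remains, after division by `T` (`integral_source_mul_cutoff_le`), is
`∫ f b (log N / L) ≤ C T ^ (-Q / 2) e ^ (2 Q L / d) + C L ^ (-Q / 2) ∫ r ^ (-Q)`,
the last integral being over the support of the cutoff, on which it is at most of order `L`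
(`exists_annuli_bound`). Let `T → ∞` and then `L → ∞`: the right side is of order `L ^ (1 - Q / 2)`
and tends to `0` because `Q > 2`, whereas the left side stays above a positive constant
(`exists_pos_eventually_le_integral_mul`). The estimates only see the absolute value of
the sub-Laplacian, so they apply to both sign conventions.
-/

namespace Stratified

/-! ### The cutoff profile -/

/-- A smooth cutoff `b` whose first two derivatives are bounded by `b ^ ((k - 2) / k)`: the `k`-th
power of a bump function. -/
lemma exists_cutoff {k : ℕ} (hk : 2 < k) :
    ∃ b : ℝ → ℝ, ContDiff ℝ ∞ b ∧ (∀ s, 0 ≤ b s) ∧ (∀ s, b s ≤ 1) ∧ (∀ s, |s| ≤ 1 → b s = 1) ∧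
      (∀ s, 2 ≤ |s| → b s = 0) ∧ ∃ C, 0 ≤ C ∧ ∀ s,
        |deriv b s| ≤ C * b s ^ (((k : ℝ) - 2) / k) ∧
        |deriv (deriv b) s| ≤ C * b s ^ (((k : ℝ) - 2) / k) := by
  let B : ContDiffBump (0 : ℝ) := ⟨1, 2, one_pos, one_lt_two⟩
  obtain ⟨k, rfl⟩ : ∃ j, k = j + 2 := ⟨k - 2, by omega⟩
  have hB : ContDiff ℝ ∞ B := B.contDiff
  have hB' : ContDiff ℝ ∞ (deriv B) := (contDiff_infty_iff_deriv.1 hB).2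
  have hB'' : ContDiff ℝ ∞ (deriv (deriv B)) := (contDiff_infty_iff_deriv.1 hB').2
  obtain ⟨C₁, hC₁⟩ := hB'.continuous.bounded_above_of_compact_support
    B.hasCompactSupport.deriv
  obtain ⟨C₂, hC₂⟩ := hB''.continuous.bounded_above_of_compact_support
    B.hasCompactSupport.deriv.deriv
  simp only [Real.norm_eq_abs] at hC₁ hC₂
  have h0 : ∀ s, 0 ≤ B s := fun s => B.nonneg
  have h1 : ∀ s, B s ≤ 1 := fun s => B.le_one
  have hd : deriv (fun s => B s ^ (k + 2)) = fun s => (k + 2) * B s ^ (k + 1) * deriv B s := by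
    ext s
    have := ((hB.differentiable (by simp)) s).hasDerivAt.pow (k + 2)
    simpa [Pi.pow_def] using this.deriv
  have hdd : deriv (deriv (fun s => B s ^ (k + 2))) = fun s =>
      (k + 2) * ((k + 1) * B s ^ k * deriv B s * deriv B s + B s ^ (k + 1) * deriv (deriv B) s) := by
    rw [hd]
    ext s
    have h := (((hB.differentiable (by simp)) s).hasDerivAt.pow (k + 1)).mul
      ((hB'.differentiable (by simp)) s).hasDerivAt |>.const_mul ((k : ℝ) + 2)
    have h' := h.deriv
    simp only [Pi.mul_apply, Pi.pow_apply] at h'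
    simp only [mul_assoc] at h' ⊢
    rw [h']
    push_cast
    ring
  have hpow : ∀ s, (B s ^ (k + 2)) ^ ((((k + 2 : ℕ) : ℝ) - 2) / ((k + 2 : ℕ) : ℝ)) = B s ^ k := by
    intro s
    rw [← Real.rpow_natCast, ← Real.rpow_mul (h0 s), ← Real.rpow_natCast]
    congr 1
    have : ((k + 2 : ℕ) : ℝ) ≠ 0 := by positivity
    push_cast
    field_simp
    ring
  have hC₁0 : 0 ≤ C₁ := (abs_nonneg _).trans (hC₁ 0)
  have hC₂0 : 0 ≤ C₂ := (abs_nonneg _).trans (hC₂ 0)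
  have hstep : ∀ s, B s ^ (k + 1) ≤ B s ^ k := fun s =>
    pow_le_pow_of_le_one (h0 s) (h1 s) (by omega)
  refine ⟨fun s => B s ^ (k + 2), hB.pow _, fun s => pow_nonneg (h0 s) _,
    fun s => pow_le_one₀ (h0 s) (h1 s), fun s hs => ?_, fun s hs => ?_,
    (k + 2) * C₁ + (k + 2) * ((k + 1) * C₁ * C₁ + C₂), by positivity, fun s => ⟨?_, ?_⟩⟩
  · have : B s = 1 := B.one_of_mem_closedBall (by simpa [B] using hs)
    simp [this]
  · have : B s = 0 := B.zero_of_le_dist (by simpa [B] using hs)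
    simp [this]
  · simp only [hpow, hd]
    have hb : 0 ≤ B s ^ k := pow_nonneg (h0 s) _
    have hb1 : 0 ≤ B s ^ (k + 1) := pow_nonneg (h0 s) _
    have hle := hstep s
    generalize B s ^ (k + 1) = P at hb1 hle ⊢
    calc |(k + 2) * P * deriv B s|
        = (k + 2) * P * |deriv B s| := by
          rw [abs_mul, abs_of_nonneg (mul_nonneg (by positivity) hb1)]
      _ ≤ (k + 2) * B s ^ k * C₁ := by
          gcongr
          exact hC₁ s
      _ = ((k + 2) * C₁) * B s ^ k := by ring
      _ ≤ ((k + 2) * C₁ + (k + 2) * ((k + 1) * C₁ * C₁ + C₂)) * B s ^ k :=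
          mul_le_mul_of_nonneg_right (le_add_of_nonneg_right (by positivity)) hb
  · simp only [hpow, hdd]
    have hb : 0 ≤ B s ^ k := pow_nonneg (h0 s) _
    have hb1 : 0 ≤ B s ^ (k + 1) := pow_nonneg (h0 s) _
    have hle := hstep s
    generalize B s ^ (k + 1) = P at hb1 hle ⊢
    calc |(k + 2) * ((k + 1) * B s ^ k * deriv B s * deriv B s + P * deriv (deriv B) s)|
        ≤ (k + 2) * ((k + 1) * B s ^ k * |deriv B s| * |deriv B s|
            + P * |deriv (deriv B) s|) := by
          rw [abs_mul, abs_of_nonneg (by positivity : (0 : ℝ) ≤ k + 2)]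
          gcongr
          refine (abs_add_le _ _).trans (le_of_eq ?_)
          simp only [abs_mul, abs_of_nonneg hb, abs_of_nonneg hb1,
            abs_of_nonneg (by positivity : (0 : ℝ) ≤ k + 1)]
      _ ≤ (k + 2) * ((k + 1) * B s ^ k * C₁ * C₁ + B s ^ k * C₂) := by
          gcongr
          · exact hC₁ s
          · exact hC₁ s
          · exact hC₂ s
      _ = ((k + 2) * ((k + 1) * C₁ * C₁ + C₂)) * B s ^ k := by ring
      _ ≤ ((k + 2) * C₁ + (k + 2) * ((k + 1) * C₁ * C₁ + C₂)) * B s ^ k :=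
          mul_le_mul_of_nonneg_right (le_add_of_nonneg_left (by positivity)) hb

/-- The cutoff `b` as a function of `log s / L`; it is zero on `(-∞, 0]`, where `Real.log` has junk
values. -/
noncomputable def logCut (b : ℝ → ℝ) (L : ℝ) (s : ℝ) : ℝ :=
  if s ≤ 0 then 0 else b (Real.log s / L)

lemma logCut_of_pos (b : ℝ → ℝ) (L : ℝ) {s : ℝ} (hs : 0 < s) :
    logCut b L s = b (Real.log s / L) := by
  simp [logCut, not_le.mpr hs]

lemma logCut_eventuallyEq (b : ℝ → ℝ) (L : ℝ) {s : ℝ} (hs : 0 < s) :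
    logCut b L =ᶠ[nhds s] fun s => b (Real.log s / L) := by
  filter_upwards [lt_mem_nhds hs] with r hr using logCut_of_pos b L hr

lemma logCut_of_lt_exp {b : ℝ → ℝ} (hb : ∀ s, 2 ≤ |s| → b s = 0) {L : ℝ} (hL : 0 < L) {s : ℝ}
    (hs : s < Real.exp (-(2 * L))) : logCut b L s = 0 := by
  rcases le_or_gt s 0 with h | h
  · simp [logCut, h]
  · rw [logCut_of_pos b L h]
    apply hb
    rw [abs_div, abs_of_pos hL, le_div_iff₀ hL]
    have := (Real.log_lt_iff_lt_exp h).2 hs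
    exact le_trans (by linarith) (neg_le_abs _)

lemma logCut_of_exp_lt {b : ℝ → ℝ} (hb : ∀ s, 2 ≤ |s| → b s = 0) {L : ℝ} (hL : 0 < L) {s : ℝ}
    (hs : Real.exp (2 * L) < s) : logCut b L s = 0 := by
  have h : 0 < s := (Real.exp_pos _).trans hs
  rw [logCut_of_pos b L h]
  apply hb
  rw [abs_div, abs_of_pos hL, le_div_iff₀ hL]
  have := (Real.lt_log_iff_exp_lt h).2 hs
  exact le_trans (by linarith) (le_abs_self _)

lemma contDiff_logCut {b : ℝ → ℝ} (hb : ContDiff ℝ ∞ b) (hb0 : ∀ s, 2 ≤ |s| → b s = 0) {L : ℝ}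
    (hL : 0 < L) : ContDiff ℝ ∞ (logCut b L) := by
  rw [contDiff_iff_contDiffAt]
  intro s
  rcases lt_or_ge 0 s with h | h
  · refine ContDiffAt.congr_of_eventuallyEq ?_ (logCut_eventuallyEq b L h)
    exact hb.contDiffAt.comp s ((Real.contDiffAt_log.2 h.ne').div_const L)
  · refine (contDiffAt_const (c := (0 : ℝ))).congr_of_eventuallyEq ?_
    filter_upwards [gt_mem_nhds (h.trans_lt (Real.exp_pos (-(2 * L))))] with r hr
    exact logCut_of_lt_exp hb0 hL hr

lemma deriv_logCut {b : ℝ → ℝ} (hb : ContDiff ℝ ∞ b) (L : ℝ) {s : ℝ}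
    (hs : 0 < s) : deriv (logCut b L) s = deriv b (Real.log s / L) * (s⁻¹ / L) := by
  rw [(logCut_eventuallyEq b L hs).deriv_eq]
  exact (((hb.differentiable (by simp)) _).hasDerivAt.comp s
    ((Real.hasDerivAt_log hs.ne').div_const L)).deriv

lemma deriv_deriv_logCut {b : ℝ → ℝ} (hb : ContDiff ℝ ∞ b) (L : ℝ) {s : ℝ} (hs : 0 < s) :
    deriv (deriv (logCut b L)) s =
      deriv (deriv b) (Real.log s / L) * (s⁻¹ / L) * (s⁻¹ / L)
        + deriv b (Real.log s / L) * (-(s ^ 2)⁻¹ / L) := by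
  have h : deriv (logCut b L) =ᶠ[nhds s] fun s => deriv b (Real.log s / L) * (s⁻¹ / L) := by
    filter_upwards [lt_mem_nhds hs] with r hr using deriv_logCut hb L hr
  rw [h.deriv_eq]
  have hb' : ContDiff ℝ ∞ (deriv b) := (contDiff_infty_iff_deriv.1 hb).2
  exact ((((hb'.differentiable (by simp)) _).hasDerivAt.comp s
    ((Real.hasDerivAt_log hs.ne').div_const L)).mul ((hasDerivAt_inv hs.ne').div_const L)).deriv

lemma abs_deriv_logCut_le {b : ℝ → ℝ} (hb : ContDiff ℝ ∞ b) {C α : ℝ}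
    (hC : ∀ s, |deriv b s| ≤ C * b s ^ α) {L : ℝ} (hL : 1 ≤ L) {s : ℝ} (hs : 0 < s) :
    |deriv (logCut b L) s| ≤ C / L * logCut b L s ^ α / s := by
  have hL0 : 0 < L := by linarith
  rw [deriv_logCut hb L hs, logCut_of_pos b L hs, abs_mul,
    abs_of_pos (by positivity : 0 < s⁻¹ / L)]
  refine (mul_le_mul_of_nonneg_right (hC _) (by positivity)).trans (le_of_eq ?_)
  field_simp

lemma abs_deriv_deriv_logCut_le {b : ℝ → ℝ} (hb : ContDiff ℝ ∞ b) {C α : ℝ}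
    (hC : ∀ s, |deriv b s| ≤ C * b s ^ α) (hC' : ∀ s, |deriv (deriv b) s| ≤ C * b s ^ α)
    {L : ℝ} (hL : 1 ≤ L) {s : ℝ} (hs : 0 < s) :
    |deriv (deriv (logCut b L)) s| ≤ 2 * C / L * logCut b L s ^ α / s ^ 2 := by
  have hL0 : 0 < L := by linarith
  rw [deriv_deriv_logCut hb L hs, logCut_of_pos b L hs]
  set r := Real.log s / L
  have hr : 0 ≤ C * b r ^ α := (abs_nonneg _).trans (hC r)
  have h1 : |deriv (deriv b) r * (s⁻¹ / L) * (s⁻¹ / L)| ≤ C * b r ^ α * (1 / (s ^ 2 * L)) := by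
    rw [mul_assoc, abs_mul, abs_of_pos (by positivity : 0 < s⁻¹ / L * (s⁻¹ / L))]
    refine mul_le_mul (hC' r) ?_ (by positivity) hr
    rw [div_mul_div_comm, ← mul_inv, ← one_div, div_div, ← sq]
    gcongr
    nlinarith
  have h2 : |deriv b r * (-(s ^ 2)⁻¹ / L)| ≤ C * b r ^ α * (1 / (s ^ 2 * L)) := by
    rw [abs_mul, neg_div, abs_neg, abs_of_pos (by positivity : 0 < (s ^ 2)⁻¹ / L)]
    refine mul_le_mul (hC r) (le_of_eq ?_) (by positivity) hr
    field_simp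
  refine (abs_add_le _ _).trans ((add_le_add h1 h2).trans (le_of_eq ?_))
  field_simp
  ring

/-! ### A smooth homogeneous gauge -/

namespace HomogeneousGroup

variable {n : ℕ} (G : HomogeneousGroup n)

/-- A common degree `2 σ₁ ⋯ σₙ`, in which even powers of all coordinates are homogeneous. -/
def gaugeDeg : ℕ := 2 * ∏ i, G.σ i

/-- The polynomial `∑ xᵢ ^ (d / σᵢ)`, `d = 2 σ₁ ⋯ σₙ`. It is homogeneous of degree `d` and vanishes
only at `0`, so that its `d`-th root is a homogeneous norm. -/
def gauge (x : Fin n → ℝ) : ℝ := ∑ i, x i ^ (2 * ∏ j ∈ Finset.univ.erase i, G.σ j)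

lemma gaugeDeg_eq (i : Fin n) :
    G.gaugeDeg = G.σ i * (2 * ∏ j ∈ Finset.univ.erase i, G.σ j) := by
  rw [gaugeDeg, ← Finset.mul_prod_erase Finset.univ G.σ (Finset.mem_univ i)]
  ring

lemma two_le_gaugeDeg : 2 ≤ G.gaugeDeg := by
  have : 0 < ∏ i, G.σ i := Finset.prod_pos fun i _ => G.one_le_σ i
  unfold gaugeDeg
  omega

lemma gauge_dil (l : ℝ) (x : Fin n → ℝ) : G.gauge (G.dil l x) = l ^ G.gaugeDeg * G.gauge x := by
  simp only [gauge, dil, Finset.mul_sum]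
  refine Finset.sum_congr rfl fun i _ => ?_
  rw [mul_pow, ← pow_mul, ← G.gaugeDeg_eq i]

lemma contDiff_gauge : ContDiff ℝ ∞ G.gauge := by
  unfold gauge
  fun_prop

lemma gauge_term_nonneg (x : Fin n → ℝ) (i : Fin n) :
    0 ≤ x i ^ (2 * ∏ j ∈ Finset.univ.erase i, G.σ j) := by
  rw [pow_mul]
  positivity

lemma gauge_nonneg (x : Fin n → ℝ) : 0 ≤ G.gauge x :=
  Finset.sum_nonneg fun i _ => G.gauge_term_nonneg x i

lemma gauge_exp_ne_zero (i : Fin n) : 2 * ∏ j ∈ Finset.univ.erase i, G.σ j ≠ 0 := by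
  have : 0 < ∏ j ∈ Finset.univ.erase i, G.σ j := Finset.prod_pos fun i _ => G.one_le_σ i
  omega

lemma gauge_zero : G.gauge 0 = 0 :=
  Finset.sum_eq_zero fun i _ => by simp [G.gauge_exp_ne_zero i]

lemma gauge_pos {x : Fin n → ℝ} (hx : x ≠ 0) : 0 < G.gauge x := by
  obtain ⟨i, hi⟩ := Function.ne_iff.1 hx
  refine Finset.sum_pos' (fun i _ => G.gauge_term_nonneg x i) ⟨i, Finset.mem_univ i, ?_⟩
  rw [pow_mul]
  have : x i ≠ 0 := hi
  positivity

lemma abs_le_one_of_gauge_le_one {x : Fin n → ℝ} (hx : G.gauge x ≤ 1) (i : Fin n) : |x i| ≤ 1 := by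
  have h : x i ^ (2 * ∏ j ∈ Finset.univ.erase i, G.σ j) ≤ 1 :=
    (Finset.single_le_sum (fun i _ => G.gauge_term_nonneg x i) (Finset.mem_univ i)).trans hx
  by_contra! hlt
  have h2 := one_lt_pow₀ hlt (G.gauge_exp_ne_zero i)
  rw [← abs_pow, abs_of_nonneg (G.gauge_term_nonneg x i)] at h2
  linarith

lemma isCompact_gauge_le_one : IsCompact {x | G.gauge x ≤ 1} := by
  refine (isCompact_closedBall (0 : Fin n → ℝ) 1).of_isClosed_subset
    (isClosed_le G.contDiff_gauge.continuous continuous_const) fun x hx => ?_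
  rw [mem_closedBall_zero_iff, pi_norm_le_iff_of_nonneg zero_le_one]
  exact fun i => G.abs_le_one_of_gauge_le_one hx i

lemma dil_inv_dil {l : ℝ} (hl : l ≠ 0) (x : Fin n → ℝ) : G.dil l⁻¹ (G.dil l x) = x := by
  ext i
  simp [dil, hl]

/-- The homogeneous norm of `x`, a `d`-th root of the gauge. -/
lemma exists_scale {x : Fin n → ℝ} (hx : x ≠ 0) :
    ∃ r : ℝ, 0 < r ∧ r ^ G.gaugeDeg = G.gauge x := by
  have hd : G.gaugeDeg ≠ 0 := by have := G.two_le_gaugeDeg; omega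
  have hp := G.gauge_pos hx
  have h : (G.gauge x ^ ((G.gaugeDeg : ℝ)⁻¹)) ^ G.gaugeDeg = G.gauge x :=
    Real.rpow_inv_natCast_pow hp.le hd
  exact ⟨G.gauge x ^ ((G.gaugeDeg : ℝ)⁻¹), Real.rpow_pos_of_pos hp _, h⟩

/-- A continuous function that is homogeneous of degree `e` is bounded by a multiple of the `e`-th
power of the homogeneous norm, by compactness of the unit sphere of the gauge. -/
lemma exists_bound_of_homogeneous {h : (Fin n → ℝ) → ℝ} (hc : Continuous h) (e : ℕ)
    (hh : ∀ l : ℝ, 0 < l → ∀ x, h (G.dil l x) = l ^ e * h x) :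
    ∃ C, 0 ≤ C ∧ ∀ (r : ℝ) (x : Fin n → ℝ), 0 < r → x ≠ 0 → r ^ G.gaugeDeg = G.gauge x →
      |h x| ≤ C * r ^ e := by
  obtain ⟨C, hC⟩ := G.isCompact_gauge_le_one.exists_bound_of_continuousOn hc.continuousOn
  simp only [Real.norm_eq_abs] at hC
  refine ⟨C, (abs_nonneg _).trans (hC 0 (by simp [gauge_zero])), fun r x hr hx hrx => ?_⟩
  have h1 : G.gauge (G.dil r⁻¹ x) = 1 := by
    rw [gauge_dil, inv_pow, hrx, inv_mul_cancel₀ (G.gauge_pos hx).ne']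
  have h2 := hC _ h1.le
  rw [hh _ (inv_pos.2 hr), abs_mul, abs_of_pos (by positivity), inv_pow,
    inv_mul_le_iff₀ (by positivity)] at h2
  linarith

/-! ### Volume of gauge balls -/

/-- The dilations scale Lebesgue measure by `l ^ Q`. -/
lemma volume_gauge_le {l : ℝ} (hl : 0 < l) :
    volume {x | G.gauge x ≤ l ^ G.gaugeDeg}
      = ENNReal.ofReal (l ^ G.homDim) * volume {x | G.gauge x ≤ 1} := by
  let A : (Fin n → ℝ) →ₗ[ℝ] (Fin n → ℝ) := Matrix.toLin' (Matrix.diagonal fun i => l⁻¹ ^ G.σ i)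
  have hA : ∀ x, A x = G.dil l⁻¹ x := fun x => by
    ext i
    simp [A, dil, Matrix.mulVec_diagonal]
  have hdet : LinearMap.det A = (l ^ G.homDim)⁻¹ := by
    simp [A, LinearMap.det_toLin', Matrix.det_diagonal, homDim, Finset.prod_pow_eq_pow_sum]
  have hset : {x | G.gauge x ≤ l ^ G.gaugeDeg} = A ⁻¹' {x | G.gauge x ≤ 1} := by
    ext x
    have : 0 < l ^ G.gaugeDeg := by positivity
    simp only [mem_ofPred_eq, mem_preimage, hA, gauge_dil, inv_pow]
    rw [inv_mul_le_iff₀ this, mul_one]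
  have hpos : 0 < l ^ G.homDim := by positivity
  rw [hset, Measure.addHaar_preimage_linearMap volume (by rw [hdet]; positivity), hdet, inv_inv,
    abs_of_pos hpos]

lemma isCompact_gauge_le (s : ℝ) : IsCompact {x | G.gauge x ≤ s} := by
  have hd : G.gaugeDeg ≠ 0 := by have := G.two_le_gaugeDeg; omega
  set l : ℝ := max s 1 with hl
  have hl1 : 1 ≤ l := le_max_right _ _
  have hll : s ≤ l ^ G.gaugeDeg := (le_max_left _ _).trans (le_self_pow₀ hl1 hd)
  have hc : Continuous (G.dil l) := by unfold dil; fun_prop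
  refine (G.isCompact_gauge_le_one.image hc).of_isClosed_subset
    (isClosed_le G.contDiff_gauge.continuous continuous_const) fun x hx => ?_
  refine ⟨G.dil l⁻¹ x, ?_, ?_⟩
  · have : 0 < l ^ G.gaugeDeg := by positivity
    simp only [mem_ofPred_eq, gauge_dil, inv_pow] at hx ⊢
    rw [inv_mul_le_iff₀ this, mul_one]
    exact hx.trans hll
  · simpa using G.dil_inv_dil (l := l⁻¹) (by positivity) x

/-- `volume {gauge ≤ s}` is `s ^ (Q / d)` times the volume of the unit ball. -/
lemma volume_real_gauge_le {s : ℝ} (hs : 0 < s) :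
    volume.real {x | G.gauge x ≤ s}
      = s ^ ((G.homDim : ℝ) / G.gaugeDeg) * volume.real {x | G.gauge x ≤ 1} := by
  have hd : G.gaugeDeg ≠ 0 := by have := G.two_le_gaugeDeg; omega
  have hl : 0 < s ^ ((G.gaugeDeg : ℝ)⁻¹) := Real.rpow_pos_of_pos hs _
  have h := G.volume_gauge_le hl
  rw [Real.rpow_inv_natCast_pow hs.le hd] at h
  rw [measureReal_def, h, ENNReal.toReal_mul, ENNReal.toReal_ofReal (by positivity),
    ← measureReal_def, ← Real.rpow_natCast, ← Real.rpow_mul hs.le]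
  congr 2
  ring

/-! ### Derivatives along fields of the first stratum -/

/-- Left-invariant fields are smooth, since they are determined by their value at `0`. -/
lemma contDiff_of_mem_leftInvariant {X : (Fin n → ℝ) → (Fin n → ℝ)} (hX : X ∈ G.leftInvariant) :
    ContDiff ℝ ∞ X := by
  have h : X = fun a => fderiv ℝ (G.mul a) 0 (X 0) := by
    ext1 a
    have := hX a 0
    rwa [G.mul_zero] at this
  rw [h]
  refine ContDiff.clm_apply ?_ contDiff_const
  exact ContDiff.fderiv (m := ∞) G.contDiff_mul contDiff_const (by simp)

end HomogeneousGroup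

lemma contDiff_applyField {n : ℕ} {X : (Fin n → ℝ) → (Fin n → ℝ)} (hX : ContDiff ℝ ∞ X)
    {φ : (Fin n → ℝ) → ℝ} (hφ : ContDiff ℝ ∞ φ) : ContDiff ℝ ∞ (applyField X φ) :=
  (hφ.fderiv_right (m := ∞) (by simp)).clm_apply hX

lemma applyField_mul {n : ℕ} (X : (Fin n → ℝ) → (Fin n → ℝ)) {φ ψ : (Fin n → ℝ) → ℝ}
    {x : Fin n → ℝ} (hφ : DifferentiableAt ℝ φ x) (hψ : DifferentiableAt ℝ ψ x) :
    applyField X (fun x => φ x * ψ x) x = applyField X φ x * ψ x + φ x * applyField X ψ x := by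
  simp only [applyField, fderiv_fun_mul hφ hψ]
  simp
  ring

lemma applyField_comp {n : ℕ} (X : (Fin n → ℝ) → (Fin n → ℝ)) {q : ℝ → ℝ} {φ : (Fin n → ℝ) → ℝ}
    {x : Fin n → ℝ} (hq : DifferentiableAt ℝ q (φ x)) (hφ : DifferentiableAt ℝ φ x) :
    applyField X (fun x => q (φ x)) x = deriv q (φ x) * applyField X φ x := by
  have h := (hq.hasDerivAt.comp_hasFDerivAt x hφ.hasFDerivAt).fderiv
  simp only [Function.comp_def] at h
  simp [applyField, h]

lemma applyField_const_mul {n : ℕ} (X : (Fin n → ℝ) → (Fin n → ℝ)) (c : ℝ)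
    {φ : (Fin n → ℝ) → ℝ} (hφ : Differentiable ℝ φ) :
    applyField X (fun x => c * φ x) = fun x => c * applyField X φ x := by
  ext x
  rw [applyField_mul X (by fun_prop) hφ.differentiableAt]
  simp [applyField]

/-- A field of the first stratum lowers the degree of homogeneity by one. -/
lemma applyField_dil {n : ℕ} (G : HomogeneousGroup n) {X : (Fin n → ℝ) → (Fin n → ℝ)}
    (hX : X ∈ G.firstStratum) {h : (Fin n → ℝ) → ℝ} (hd : Differentiable ℝ h) {e : ℕ}
    (hh : ∀ l : ℝ, 0 < l → ∀ x, h (G.dil l x) = l ^ (e + 1) * h x) :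
    ∀ l : ℝ, 0 < l → ∀ x, applyField X h (G.dil l x) = l ^ e * applyField X h x := by
  intro l hl x
  let A : (Fin n → ℝ) →L[ℝ] (Fin n → ℝ) :=
    LinearMap.toContinuousLinearMap (Matrix.toLin' (Matrix.diagonal fun i => l ^ G.σ i))
  have hA : ∀ x, A x = G.dil l x := fun x => by
    ext i
    simp [A, HomogeneousGroup.dil, Matrix.mulVec_diagonal]
  have h1 : HasFDerivAt (fun y => h (A y)) ((fderiv ℝ h (A x)).comp A) x :=
    (hd (A x)).hasFDerivAt.comp x A.hasFDerivAt
  have h2 : HasFDerivAt (fun y => h (A y)) (l ^ (e + 1) • fderiv ℝ h x) x := by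
    simp only [hA, hh l hl]
    exact (hd x).hasFDerivAt.const_mul (l ^ (e + 1))
  have h3 := congrArg (fun B => B (X x)) (h1.unique h2)
  simp only [ContinuousLinearMap.comp_apply, hA, hX.2 l hl x, map_smul, smul_eq_mul,
    _root_.smul_apply, pow_succ'] at h3
  simp only [applyField]
  rw [mul_assoc] at h3
  exact mul_left_cancel₀ hl.ne' h3

/-- For a field `X` of the first stratum, `X²` of the logarithmic cutoff at scale `L` of the gauge
is at most of order `1 / L` times the homogeneous norm to the power `-2`. -/
lemma exists_bound_applyField_applyField {n : ℕ} (G : HomogeneousGroup n)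
    {X : (Fin n → ℝ) → (Fin n → ℝ)} (hX : X ∈ G.firstStratum) {b : ℝ → ℝ} (hb : ContDiff ℝ ∞ b)
    (hnn : ∀ s, 0 ≤ b s) (hb0 : ∀ s, 2 ≤ |s| → b s = 0) {C α : ℝ} (hC0 : 0 ≤ C)
    (hC : ∀ s, |deriv b s| ≤ C * b s ^ α) (hC' : ∀ s, |deriv (deriv b) s| ≤ C * b s ^ α) :
    ∃ K, 0 ≤ K ∧ ∀ L : ℝ, 1 ≤ L → ∀ x, x ≠ 0 →
      |applyField X (applyField X fun x => logCut b L (G.gauge x)) x|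
        ≤ K / L * logCut b L (G.gauge x) ^ α * G.gauge x ^ (-2 / (G.gaugeDeg : ℝ)) := by
  obtain ⟨e, he⟩ : ∃ e, G.gaugeDeg = e + 2 := ⟨G.gaugeDeg - 2, by have := G.two_le_gaugeDeg; omega⟩
  have hXs : ContDiff ℝ ∞ X := G.contDiff_of_mem_leftInvariant hX.1
  have hN := G.contDiff_gauge
  have hN1 := contDiff_applyField hXs hN
  have hN2 := contDiff_applyField hXs hN1
  have hh0 : ∀ l : ℝ, 0 < l → ∀ x, G.gauge (G.dil l x) = l ^ (e + 1 + 1) * G.gauge x :=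
    fun l _ x => by rw [G.gauge_dil, he]
  have hh1 := applyField_dil G hX (hN.differentiable (by simp)) hh0
  have hh2 := applyField_dil G hX (hN1.differentiable (by simp)) hh1
  obtain ⟨K₁, hK₁, H₁⟩ := G.exists_bound_of_homogeneous hN1.continuous _ hh1
  obtain ⟨K₂, hK₂, H₂⟩ := G.exists_bound_of_homogeneous hN2.continuous _ hh2
  refine ⟨2 * C * K₁ ^ 2 + C * K₂, by positivity, fun L hL x hx => ?_⟩
  have hL0 : 0 < L := by linarith
  have hq : ContDiff ℝ ∞ (logCut b L) := contDiff_logCut hb hb0 hL0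
  have hq1 : ContDiff ℝ ∞ (deriv (logCut b L)) := (contDiff_infty_iff_deriv.1 hq).2
  have hq' := hq.differentiable (by simp)
  have hq1' := hq1.differentiable (by simp)
  have hN' := hN.differentiable (by simp)
  have hN1' := hN1.differentiable (by simp)
  obtain ⟨r, hr, hrx⟩ := G.exists_scale hx
  have hNx := G.gauge_pos hx
  have h1 : (applyField X fun x => logCut b L (G.gauge x))
      = fun x => deriv (logCut b L) (G.gauge x) * applyField X G.gauge x :=
    funext fun x => applyField_comp X (hq' _) (hN' x)
  have h2 : applyField X (applyField X fun x => logCut b L (G.gauge x)) x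
      = deriv (deriv (logCut b L)) (G.gauge x) * applyField X G.gauge x * applyField X G.gauge x
        + deriv (logCut b L) (G.gauge x) * applyField X (applyField X G.gauge) x := by
    have hc : DifferentiableAt ℝ (fun x => deriv (logCut b L) (G.gauge x)) x :=
      (hq1' _).comp x (hN' x)
    rw [h1, applyField_mul X hc (hN1' x), applyField_comp X (hq1' _) (hN' x)]
  have hpow : G.gauge x ^ (-2 / (G.gaugeDeg : ℝ)) = (r ^ 2)⁻¹ := by
    have : (G.gaugeDeg : ℝ) ≠ 0 := by rw [he]; positivity
    rw [← hrx, ← Real.rpow_natCast, ← Real.rpow_mul hr.le, ← Real.rpow_natCast,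
      ← Real.rpow_neg hr.le]
    congr 1
    field_simp
    norm_num
  rw [h2, hpow]
  have b1 := abs_deriv_logCut_le hb hC hL hNx
  have b2 := abs_deriv_deriv_logCut_le hb hC hC' hL hNx
  have c1 := H₁ r x hr hx hrx
  have c2 := H₂ r x hr hx hrx
  have hq0 : 0 ≤ logCut b L (G.gauge x) ^ α := by
    rw [logCut_of_pos b L hNx]
    exact Real.rpow_nonneg (hnn _) _
  have hre : G.gauge x = r ^ (e + 2) := by rw [← hrx, he]
  generalize deriv (deriv (logCut b L)) (G.gauge x) = D₂ at b2 ⊢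
  generalize deriv (logCut b L) (G.gauge x) = D₁ at b1 ⊢
  generalize logCut b L (G.gauge x) ^ α = P at b1 b2 hq0 ⊢
  rw [hre] at b1 b2
  calc |D₂ * applyField X G.gauge x * applyField X G.gauge x
        + D₁ * applyField X (applyField X G.gauge) x|
      ≤ |D₂| * |applyField X G.gauge x| * |applyField X G.gauge x|
        + |D₁| * |applyField X (applyField X G.gauge) x| := by
        refine (abs_add_le _ _).trans (le_of_eq ?_)
        simp only [abs_mul]
    _ ≤ 2 * C / L * P / (r ^ (e + 2)) ^ 2 * (K₁ * r ^ (e + 1)) * (K₁ * r ^ (e + 1))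
        + C / L * P / r ^ (e + 2) * (K₂ * r ^ e) := by
        gcongr
    _ = (2 * C * K₁ ^ 2 + C * K₂) / L * P * (r ^ 2)⁻¹ := by
        field_simp
        ring

lemma exists_bound_subLaplacian {n m : ℕ} (G : StratifiedGroup n)
    (X : Module.Basis (Fin m) ℝ G.firstStratum) {b : ℝ → ℝ} (hb : ContDiff ℝ ∞ b)
    (hnn : ∀ s, 0 ≤ b s) (hb0 : ∀ s, 2 ≤ |s| → b s = 0) {C α : ℝ} (hC0 : 0 ≤ C)
    (hC : ∀ s, |deriv b s| ≤ C * b s ^ α) (hC' : ∀ s, |deriv (deriv b) s| ≤ C * b s ^ α) :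
    ∃ K, 0 ≤ K ∧ ∀ L : ℝ, 1 ≤ L → ∀ x, x ≠ 0 →
      |subLaplacian G X (fun x => logCut b L (G.gauge x)) x|
        ≤ K / L * logCut b L (G.gauge x) ^ α * G.gauge x ^ (-2 / (G.gaugeDeg : ℝ)) := by
  choose K hK H using fun k =>
    exists_bound_applyField_applyField G.toHomogeneousGroup (X k).2 hb hnn hb0 hC0 hC hC'
  refine ⟨∑ k, K k, Finset.sum_nonneg fun k _ => hK k, fun L hL x hx => ?_⟩
  refine (Finset.abs_sum_le_sum_abs _ _).trans ?_
  simp only [Finset.sum_div, Finset.sum_mul]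
  exact Finset.sum_le_sum fun k _ => H k L hL x hx

lemma subLaplacian_const_mul {n m : ℕ} (G : StratifiedGroup n)
    (X : Module.Basis (Fin m) ℝ G.firstStratum) (c : ℝ) {φ : (Fin n → ℝ) → ℝ}
    (hφ : ContDiff ℝ ∞ φ) (x : Fin n → ℝ) :
    subLaplacian G X (fun x => c * φ x) x = c * subLaplacian G X φ x := by
  have hX : ∀ k, ContDiff ℝ ∞ (X k : (Fin n → ℝ) → (Fin n → ℝ)) := fun k =>
    G.contDiff_of_mem_leftInvariant (X k).2.1
  simp only [subLaplacian, Finset.mul_sum]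
  refine Finset.sum_congr rfl fun k _ => ?_
  rw [applyField_const_mul _ _ (hφ.differentiable (by simp)), applyField_const_mul _ _
    ((contDiff_applyField (hX k) hφ).differentiable (by simp))]

/-! ### Test functions -/

lemma isTestFunction_mul {n : ℕ} {a : ℝ → ℝ} {φ : (Fin n → ℝ) → ℝ} (ha : ContDiff ℝ ∞ a)
    (hac : HasCompactSupport a) (ha0 : ∀ t, 0 ≤ a t) (hφ : ContDiff ℝ ∞ φ)
    (hφc : HasCompactSupport φ) (hφ0 : ∀ x, 0 ≤ φ x) (hφs : tsupport φ ⊆ {0}ᶜ) :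
    IsTestFunction (fun t x => a t * φ x) := by
  have hzero : ∀ z : ℝ × (Fin n → ℝ), z ∉ tsupport a ×ˢ tsupport φ → a z.1 * φ z.2 = 0 := by
    intro z hz
    rw [mem_prod, not_and_or] at hz
    rcases hz with h | h <;> simp [image_eq_zero_of_notMem_tsupport h]
  have hd : ∀ t x, deriv (fun s => a s * φ x) t = deriv a t * φ x := fun t x =>
    deriv_mul_const_field (φ x)
  have ha' : ContDiff ℝ ∞ (deriv a) := (contDiff_infty_iff_deriv.1 ha).2
  have hit : ∀ {c : ℝ → ℝ}, Continuous c → ∀ k : ℕ, Continuous (fun z : ℝ × (Fin n → ℝ) =>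
      iteratedFDeriv ℝ k (fun x => c z.1 * φ x) z.2) := by
    intro c hc k
    have hk : ContDiff ℝ k φ := hφ.of_le (by exact_mod_cast le_top)
    have : (fun z : ℝ × (Fin n → ℝ) => iteratedFDeriv ℝ k (fun x => c z.1 * φ x) z.2)
        = fun z => c z.1 • iteratedFDeriv ℝ k φ z.2 := by
      ext1 z
      simpa only [smul_eq_mul] using
        iteratedFDeriv_const_smul_apply' (a := c z.1) (hk.contDiffAt (x := z.2))
    rw [this]
    exact (hc.comp continuous_fst).smul
      ((hk.continuous_iteratedFDeriv le_rfl).comp continuous_snd)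
  have h2 : ContDiff ℝ 2 φ := by exact_mod_cast contDiff_infty.1 hφ 2
  refine ⟨fun t _ x => mul_nonneg (ha0 t) (hφ0 x),
    HasCompactSupport.intro (hac.isCompact.prod hφc.isCompact) hzero, ?_,
    fun t => contDiff_const.mul h2, fun k _ => hit ha.continuous k,
    fun x => (ha.differentiable (by simp)).mul_const _, fun t => ?_, fun k _ => ?_⟩
  · refine (closure_minimal (fun z hz => ?_)
      ((isClosed_tsupport a).prod (isClosed_tsupport φ))).trans
      (prod_mono (subset_univ _) hφs)
    by_contra h
    exact hz (hzero z h)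
  · simp only [hd]
    exact contDiff_const.mul h2
  · simp only [hd]
    exact hit ha'.continuous k

section Spatial

variable {n : ℕ} (G : HomogeneousGroup n) {b : ℝ → ℝ} {L : ℝ}

lemma tsupport_logCut_gauge_subset (hb0 : ∀ s, 2 ≤ |s| → b s = 0) (hL : 0 < L) :
    tsupport (fun x => logCut b L (G.gauge x))
      ⊆ {x | Real.exp (-(2 * L)) ≤ G.gauge x ∧ G.gauge x ≤ Real.exp (2 * L)} := by
  have hc := G.contDiff_gauge.continuous
  refine closure_minimal (fun x hx => ?_)
    ((isClosed_le continuous_const hc).inter (isClosed_le hc continuous_const))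
  refine ⟨?_, ?_⟩
  · by_contra! h
    exact hx (logCut_of_lt_exp hb0 hL h)
  · by_contra! h
    exact hx (logCut_of_exp_lt hb0 hL h)

lemma tsupport_logCut_gauge_subset_compl (hb0 : ∀ s, 2 ≤ |s| → b s = 0) (hL : 0 < L) :
    tsupport (fun x => logCut b L (G.gauge x)) ⊆ {0}ᶜ := by
  rintro x hx rfl
  have h := (tsupport_logCut_gauge_subset G hb0 hL hx).1
  rw [G.gauge_zero] at h
  exact h.not_gt (Real.exp_pos _)

lemma hasCompactSupport_logCut_gauge (hb0 : ∀ s, 2 ≤ |s| → b s = 0) (hL : 0 < L) :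
    HasCompactSupport (fun x => logCut b L (G.gauge x)) :=
  (G.isCompact_gauge_le (Real.exp (2 * L))).of_isClosed_subset (isClosed_tsupport _)
    fun _ hx => (tsupport_logCut_gauge_subset G hb0 hL hx).2

lemma contDiff_logCut_gauge (hb : ContDiff ℝ ∞ b) (hb0 : ∀ s, 2 ≤ |s| → b s = 0) (hL : 0 < L) :
    ContDiff ℝ ∞ (fun x => logCut b L (G.gauge x)) :=
  (contDiff_logCut hb hb0 hL).comp G.contDiff_gauge

lemma logCut_nonneg (hnn : ∀ s, 0 ≤ b s) (L s : ℝ) : 0 ≤ logCut b L s := by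
  unfold logCut
  split_ifs
  · exact le_rfl
  · exact hnn _

lemma logCut_le_one (hle : ∀ s, b s ≤ 1) (L s : ℝ) : logCut b L s ≤ 1 := by
  unfold logCut
  split_ifs
  · exact zero_le_one
  · exact hle _

lemma tendsto_logCut_gauge (h1 : ∀ s, |s| ≤ 1 → b s = 1) {x : Fin n → ℝ} (hx : x ≠ 0) :
    Filter.Tendsto (fun k : ℕ => logCut b k (G.gauge x)) Filter.atTop (nhds 1) := by
  refine tendsto_const_nhds.congr' ?_
  filter_upwards [Filter.eventually_ge_atTop (max 1 ⌈|Real.log (G.gauge x)|⌉₊)] with k hk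
  have hk1 : (1 : ℝ) ≤ k := by exact_mod_cast (le_max_left _ _).trans hk
  have hk2 : |Real.log (G.gauge x)| ≤ k := Nat.ceil_le.1 ((le_max_right _ _).trans hk)
  rw [logCut_of_pos _ _ (G.gauge_pos hx), h1]
  rw [abs_div, abs_of_pos (by linarith : (0 : ℝ) < k)]
  exact (div_le_one (by linarith)).2 hk2

/-- The integral of the homogeneous norm to the power `-Q` over the support of the cutoff at scale
`L` grows only linearly in `L`, because each of the `4 L + 1` gauge annuli between consecutive
powers of `e` contributes equally. -/
lemma exists_annuli_bound (L : ℕ) :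
    ∃ h : (Fin n → ℝ) → ℝ, Integrable h ∧ (∀ x, 0 ≤ h x) ∧
      (∀ x, Real.exp (-(2 * L)) ≤ G.gauge x → G.gauge x ≤ Real.exp (2 * L) →
        G.gauge x ^ (-((G.homDim : ℝ) / G.gaugeDeg)) ≤ h x) ∧
      ∫ x, h x ≤ (4 * L + 1) * (Real.exp ((G.homDim : ℝ) / G.gaugeDeg)
        * volume.real {x | G.gauge x ≤ 1}) := by
  set κ : ℝ := (G.homDim : ℝ) / G.gaugeDeg with hκ
  have hκ0 : 0 ≤ κ := by positivity
  have hmeas : ∀ s, MeasurableSet {x | G.gauge x ≤ s} := fun s =>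
    (isClosed_le G.contDiff_gauge.continuous continuous_const).measurableSet
  let g : ℕ → (Fin n → ℝ) → ℝ := fun j => {x | G.gauge x ≤ Real.exp (j + 1 - 2 * L)}.indicator
    fun _ => Real.exp (j - 2 * L) ^ (-κ)
  have hg0 : ∀ j x, 0 ≤ g j x := fun j x =>
    indicator_nonneg (fun _ _ => Real.rpow_nonneg (Real.exp_pos _).le _) x
  have hgi : ∀ j, Integrable (g j) := fun j => by
    refine (integrable_indicator_iff (hmeas _)).2 (integrableOn_const ?_)
    exact (G.isCompact_gauge_le _).measure_lt_top.ne
  have hgv : ∀ j, ∫ x, g j x = Real.exp κ * volume.real {x | G.gauge x ≤ 1} := fun j => by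
    simp only [g]
    rw [integral_indicator (hmeas _), setIntegral_const, G.volume_real_gauge_le (Real.exp_pos _),
      ← hκ, smul_eq_mul, mul_right_comm, ← Real.exp_mul, ← Real.exp_mul, ← Real.exp_add]
    congr 2
    ring
  refine ⟨fun x => ∑ j ∈ Finset.range (4 * L + 1), g j x,
    integrable_finsetSum _ fun j _ => hgi j, fun x => Finset.sum_nonneg fun j _ => hg0 j x,
    fun x h1 h2 => ?_, ?_⟩
  · have hpos : 0 < G.gauge x := (Real.exp_pos _).trans_le h1
    have hl1 : -(2 * L) ≤ Real.log (G.gauge x) := (Real.le_log_iff_exp_le hpos).2 h1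
    have hl2 : Real.log (G.gauge x) ≤ 2 * L := (Real.log_le_iff_le_exp hpos).2 h2
    have hnn : 0 ≤ Real.log (G.gauge x) + 2 * L := by linarith
    set j := ⌊Real.log (G.gauge x) + 2 * L⌋₊ with hj
    have hj1 : (j : ℝ) ≤ Real.log (G.gauge x) + 2 * L := Nat.floor_le hnn
    have hj2 : Real.log (G.gauge x) + 2 * L < j + 1 := Nat.lt_floor_add_one _
    have hjr : j ∈ Finset.range (4 * L + 1) := by
      rw [Finset.mem_range, Nat.lt_succ_iff]
      have : (j : ℝ) ≤ 4 * L := by linarith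
      exact_mod_cast this
    refine le_trans ?_ (Finset.single_le_sum (fun j _ => hg0 j x) hjr)
    have hmem : x ∈ {x | G.gauge x ≤ Real.exp (j + 1 - 2 * L)} :=
      (Real.log_le_iff_le_exp hpos).1 (by linarith)
    simp only [g]
    rw [indicator_of_mem hmem]
    exact Real.rpow_le_rpow_of_nonpos (Real.exp_pos _)
      ((Real.le_log_iff_exp_le hpos).1 (by linarith)) (by linarith)
  · rw [integral_finsetSum _ fun j _ => hgi j]
    simp only [hgv, Finset.sum_const, Finset.card_range, nsmul_eq_mul]
    push_cast
    exact le_rfl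

end Spatial

/-! ### The integral of the source term -/

/-- If `f` has a positive integral, possibly infinite, then the integrals of `f` against functions
`0 ≤ g k ≤ 1` that tend to `1` are eventually bounded away from `0`: the positive part is handled
by Fatou's lemma, and the negative part is integrable. -/
lemma exists_pos_eventually_le_integral_mul {Ω : Type*} [MeasurableSpace Ω] {μ : Measure Ω}
    {f : Ω → ℝ} (hf : AEStronglyMeasurable f μ)
    (hpos : ∫⁻ x, ENNReal.ofReal (-f x) ∂μ < ∫⁻ x, ENNReal.ofReal (f x) ∂μ)
    {g : ℕ → Ω → ℝ} (hg : ∀ k, Measurable (g k)) (hg0 : ∀ k x, 0 ≤ g k x)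
    (hg1 : ∀ k x, g k x ≤ 1)
    (hlim : ∀ᵐ x ∂μ, Filter.Tendsto (fun k => g k x) Filter.atTop (nhds 1))
    (hint : ∀ᶠ k in Filter.atTop, Integrable (fun x => f x * g k x) μ) :
    ∃ ε, 0 < ε ∧ ∀ᶠ k in Filter.atTop, ε ≤ ∫ x, f x * g k x ∂μ := by
  obtain ⟨c, hc1, hc2⟩ := exists_between hpos
  have hctop : c ≠ ⊤ := (hc2.trans_le le_top).ne
  have hfat : ∫⁻ x, ENNReal.ofReal (f x) ∂μ
      ≤ Filter.liminf (fun k => ∫⁻ x, ENNReal.ofReal (f x * g k x) ∂μ) Filter.atTop := by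
    refine le_trans (lintegral_mono_ae ?_) (lintegral_liminf_le' fun k =>
      (hf.aemeasurable.mul (hg k).aemeasurable).ennreal_ofReal)
    filter_upwards [hlim] with x hx
    have h := (ENNReal.continuous_ofReal.tendsto _).comp (hx.const_mul (f x))
    rw [mul_one] at h
    exact h.liminf_eq.ge
  refine ⟨c.toReal - (∫⁻ x, ENNReal.ofReal (-f x) ∂μ).toReal,
    sub_pos.2 ((ENNReal.toReal_lt_toReal hc1.ne_top hctop).2 hc1), ?_⟩
  filter_upwards [Filter.eventually_lt_of_lt_liminf (hc2.trans_le hfat), hint] with k hk hi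
  rw [integral_eq_lintegral_pos_part_sub_lintegral_neg_part hi]
  refine sub_le_sub (ENNReal.toReal_mono ?_ hk.le) (ENNReal.toReal_mono hc1.ne_top ?_)
  · exact hi.lintegral_lt_top.ne
  · refine lintegral_mono fun x => ?_
    rw [← neg_mul, ENNReal.ofReal_mul' (hg0 k x)]
    exact mul_le_of_le_one_right' (ENNReal.ofReal_le_one.2 (hg1 k x))

/-! ### The weak equation against the cutoffs -/

/-- Young's inequality with the constant `1 / 2` in front of the term to be absorbed. -/
lemma young_half {p q : ℝ} (hpq : p.HolderConjugate q) {v w c : ℝ} (hv : 0 ≤ v) (hw : 0 ≤ w)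
    (hc : 0 ≤ c) : v * w ^ p⁻¹ * c ≤ 2⁻¹ * (v ^ p * w) + 2⁻¹ * (2 * c) ^ q := by
  have h := Real.young_inequality_of_nonneg (mul_nonneg hv (Real.rpow_nonneg hw p⁻¹))
    (by positivity : 0 ≤ 2 * c) hpq
  rw [Real.mul_rpow hv (Real.rpow_nonneg hw _), Real.rpow_inv_rpow hw hpq.ne_zero] at h
  have h1 : v ^ p * w / p ≤ v ^ p * w :=
    div_le_self (mul_nonneg (Real.rpow_nonneg hv _) hw) hpq.lt.le
  have h2 : (2 * c) ^ q / q ≤ (2 * c) ^ q := div_le_self (by positivity) hpq.symm.lt.le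
  linarith

/-- A term `F` of the weak equation with `|F| ≤ |u| ψ ^ (1 / p) c` is absorbed, up to an integral
over the support of `ψ`, by half of the integral of `|u| ^ p ψ`. No measurability of `F` is
needed. -/
lemma abs_setIntegral_le {n : ℕ} {p q : ℝ} (hpq : p.HolderConjugate q)
    {u ψ F : ℝ × (Fin n → ℝ) → ℝ} {S : Set (Fin n → ℝ)} {T : ℝ} (hT : 0 ≤ T)
    (hψ : ∀ z, 0 ≤ ψ z)
    (hψS : ∀ z, ψ z ≠ 0 → z.1 ≤ T ∧ z.2 ∈ S)
    (hint : IntegrableOn (fun z => |u z| ^ p * ψ z) (Ioi 0 ×ˢ {0}ᶜ))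
    {c h : (Fin n → ℝ) → ℝ} (hc : ∀ x, 0 ≤ c x) (hh : Integrable h) (hh0 : ∀ x, 0 ≤ h x)
    (hch : ∀ x ∈ S, (2 * c x) ^ q ≤ h x)
    (hF : ∀ t x, 0 < t → x ≠ 0 → |F (t, x)| ≤ |u (t, x)| * ψ (t, x) ^ p⁻¹ * c x) :
    |∫ z in Ioi (0 : ℝ) ×ˢ ({0}ᶜ : Set (Fin n → ℝ)), F z|
      ≤ 2⁻¹ * (∫ z in Ioi (0 : ℝ) ×ˢ ({0}ᶜ : Set (Fin n → ℝ)), |u z| ^ p * ψ z)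
        + 2⁻¹ * (T * ∫ x, h x) := by
  let χ : ℝ → ℝ := (Ioc 0 T).indicator 1
  have hχ0 : ∀ t, 0 ≤ χ t := fun t => indicator_nonneg (fun _ _ => zero_le_one) t
  have hχi : Integrable χ := by
    refine (integrable_indicator_iff measurableSet_Ioc).2 ?_
    exact integrableOn_const (by simp)
  have hχv : ∫ t, χ t = T := by
    simp only [χ]
    rw [integral_indicator measurableSet_Ioc]
    simp [hT]
  have hprod : Integrable (fun z : ℝ × (Fin n → ℝ) => χ z.1 * h z.2) := hχi.mul_prod hh
  have hpv : ∫ z in Ioi (0 : ℝ) ×ˢ ({0}ᶜ : Set (Fin n → ℝ)), χ z.1 * h z.2 ≤ T * ∫ x, h x := by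
    refine (setIntegral_le_integral hprod
      (Filter.Eventually.of_forall fun z => mul_nonneg (hχ0 _) (hh0 _))).trans (le_of_eq ?_)
    rw [Measure.volume_eq_prod, integral_prod_mul, hχv]
  have key := norm_integral_le_of_norm_le (f := F)
    (μ := volume.restrict (Ioi (0 : ℝ) ×ˢ ({0}ᶜ : Set (Fin n → ℝ))))
    ((hint.const_mul 2⁻¹).add (hprod.integrableOn.const_mul 2⁻¹)) (by
      refine (ae_restrict_iff' (measurableSet_Ioi.prod
        (measurableSet_singleton _).compl)).2 (Filter.Eventually.of_forall ?_)
      rintro ⟨t, x⟩ ⟨ht, hx⟩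
      have h1 := hF t x ht hx
      rw [Real.norm_eq_abs]
      by_cases h0 : ψ (t, x) = 0
      · rw [h0, Real.zero_rpow (inv_ne_zero hpq.ne_zero)] at h1
        simp only [Pi.add_apply, h0]
        have := mul_nonneg (hχ0 t) (hh0 x)
        linarith
      · obtain ⟨htT, hxS⟩ := hψS _ h0
        have hχ1 : χ t = 1 := indicator_of_mem (show t ∈ Ioc 0 T from ⟨ht, htT⟩) _
        have h2 := young_half hpq (abs_nonneg (u (t, x))) (hψ (t, x)) (hc x)
        have h3 := hch x hxS
        simp only [Pi.add_apply, hχ1]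
        linarith)
  rw [integral_add' (hint.const_mul 2⁻¹) (hprod.integrableOn.const_mul 2⁻¹), integral_const_mul,
    integral_const_mul, Real.norm_eq_abs] at key
  linarith

/-! ### Nonexistence -/

/-- The weak equation tested with `b (t / T) b (log N / L)`, where `N` is the gauge: the source
term is bounded by the scale-invariant energy of the spatial cutoff, up to a term that vanishes as
`T → ∞`. -/
lemma integral_source_mul_cutoff_le {n : ℕ} (G : HomogeneousGroup n) {p q : ℝ}
    (hpq : p.HolderConjugate q) (hq : 2 * q = G.homDim)
    {Lap : ((Fin n → ℝ) → ℝ) → (Fin n → ℝ) → ℝ} {f u₀ : (Fin n → ℝ) → ℝ}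
    (hu₀ : ∀ᵐ x ∂(volume : Measure (Fin n → ℝ)), 0 ≤ u₀ x) {u : ℝ → (Fin n → ℝ) → ℝ}
    (hu : IsGlobalWeakSolution Lap p f u₀ u)
    {b : ℝ → ℝ} (hb : ContDiff ℝ ∞ b) (hnn : ∀ s, 0 ≤ b s) (hle : ∀ s, b s ≤ 1)
    (hb1 : ∀ s, |s| ≤ 1 → b s = 1) (hb0 : ∀ s, 2 ≤ |s| → b s = 0)
    {C : ℝ} (hC0 : 0 ≤ C) (hC : ∀ s, |deriv b s| ≤ C * b s ^ p⁻¹)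
    {K : ℝ} (hK0 : 0 ≤ K)
    (hLmul : ∀ (c : ℝ) (φ : (Fin n → ℝ) → ℝ), ContDiff ℝ ∞ φ → ∀ x,
      |Lap (fun x => c * φ x) x| = |c| * |Lap φ x|)
    (hK : ∀ L : ℝ, 1 ≤ L → ∀ x, x ≠ 0 → |Lap (fun x => logCut b L (G.gauge x)) x|
        ≤ K / L * logCut b L (G.gauge x) ^ p⁻¹ * G.gauge x ^ (-2 / (G.gaugeDeg : ℝ)))
    {L : ℕ} (hL : 1 ≤ L) {T : ℝ} (hT : 1 ≤ T) {ε : ℝ} (hε : 0 ≤ ε)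
    (hεf : ε ≤ ∫ x in ({0}ᶜ : Set (Fin n → ℝ)), f x * logCut b L (G.gauge x)) :
    ε ≤ (2 * (C / T)) ^ q * volume.real {x | G.gauge x ≤ Real.exp (2 * L)}
      + (2 * (K / L)) ^ q * ((4 * L + 1) * (Real.exp ((G.homDim : ℝ) / G.gaugeDeg)
        * volume.real {x | G.gauge x ≤ 1})) := by
  have hT0 : 0 < T := by linarith
  have hL1 : (1 : ℝ) ≤ L := by exact_mod_cast hL
  have hL0 : (0 : ℝ) < L := by linarith
  have hp0 : 0 ≤ p⁻¹ := inv_nonneg.2 hpq.nonneg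
  have hp1 : p⁻¹ ≤ 1 := inv_le_one_of_one_le₀ hpq.lt.le
  set φ : (Fin n → ℝ) → ℝ := fun x => logCut b L (G.gauge x) with hφ
  set a : ℝ → ℝ := fun t => b (t / T) with ha
  have hφs : ContDiff ℝ ∞ φ := contDiff_logCut_gauge G hb hb0 hL0
  have has : ContDiff ℝ ∞ a := hb.comp (contDiff_id.div_const T)
  have hφ0 : ∀ x, 0 ≤ φ x := fun x => logCut_nonneg hnn _ _
  have hφ1 : ∀ x, φ x ≤ 1 := fun x => logCut_le_one hle _ _
  have ha0 : ∀ t, 0 ≤ a t := fun t => hnn _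
  have ha1 : ∀ t, a t ≤ 1 := fun t => hle _
  have haT : ∀ t, 2 * T ≤ |t| → a t = 0 := fun t ht => by
    refine hb0 _ ?_
    rwa [abs_div, abs_of_pos hT0, le_div_iff₀ hT0]
  have hac : HasCompactSupport a :=
    HasCompactSupport.intro (isCompact_Icc (a := -(2 * T)) (b := 2 * T)) fun t ht => haT t (by
      by_contra! h
      exact ht (abs_le.1 h.le))
  have htest : IsTestFunction (fun t x => a t * φ x) :=
    isTestFunction_mul has hac ha0 hφs (hasCompactSupport_logCut_gauge G hb0 hL0) hφ0
      (tsupport_logCut_gauge_subset_compl G hb0 hL0)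
  set S : Set (Fin n → ℝ) :=
    {x | Real.exp (-(2 * L)) ≤ G.gauge x ∧ G.gauge x ≤ Real.exp (2 * L)} with hS
  set V := volume.real {x | G.gauge x ≤ Real.exp (2 * L)} with hV
  have hψ : ∀ z : ℝ × (Fin n → ℝ), 0 ≤ a z.1 * φ z.2 := fun z => mul_nonneg (ha0 _) (hφ0 _)
  have hψS : ∀ z : ℝ × (Fin n → ℝ), a z.1 * φ z.2 ≠ 0 → z.1 ≤ 2 * T ∧ z.2 ∈ S := by
    intro z hz
    refine ⟨?_, tsupport_logCut_gauge_subset G hb0 hL0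
      (subset_tsupport _ (right_ne_zero_of_mul hz))⟩
    by_contra! h
    exact left_ne_zero_of_mul hz (haT _ (h.le.trans (le_abs_self _)))
  have hself : ∀ s : ℝ, 0 ≤ s → s ≤ 1 → s ≤ s ^ p⁻¹ := fun s h0 h1 =>
    Real.self_le_rpow_of_le_one h0 h1 hp1
  -- The term with the time derivative.
  have hmeas : MeasurableSet {x | G.gauge x ≤ Real.exp (2 * L)} :=
    (isClosed_le G.contDiff_gauge.continuous continuous_const).measurableSet
  have hI1 := abs_setIntegral_le hpq (u := fun z => u z.1 z.2) (ψ := fun z => a z.1 * φ z.2)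
    (F := fun z => u z.1 z.2 * deriv (fun s => a s * φ z.2) z.1) (S := S) (T := 2 * T)
    (by positivity) hψ hψS (hu.integrable _ htest) (c := fun _ => C / T)
    (h := {x | G.gauge x ≤ Real.exp (2 * L)}.indicator fun _ => (2 * (C / T)) ^ q)
    (fun _ => by positivity)
    ((integrable_indicator_iff hmeas).2
      (integrableOn_const (G.isCompact_gauge_le _).measure_lt_top.ne))
    (fun x => indicator_nonneg (fun _ _ => by positivity) x)
    (fun x hx => (indicator_of_mem (show x ∈ {x | G.gauge x ≤ Real.exp (2 * L)} from hx.2)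
      fun _ => (2 * (C / T)) ^ q).ge)
    (fun t x _ _ => by
      have hda : deriv a t = deriv b (t / T) * (1 / T) :=
        (((hb.differentiable (by simp)) _).hasDerivAt.comp t
          ((hasDerivAt_id t).div_const T)).deriv
      have h1 : |deriv a t| ≤ C / T * a t ^ p⁻¹ := by
        rw [hda, abs_mul, abs_of_pos (by positivity : 0 < 1 / T)]
        refine (mul_le_mul_of_nonneg_right (hC _) (by positivity)).trans (le_of_eq ?_)
        simp only [ha]
        ring
      simp only [deriv_mul_const_field]
      rw [abs_mul, abs_mul, abs_of_nonneg (hφ0 x), Real.mul_rpow (ha0 t) (hφ0 x)]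
      have h2 : |deriv a t| * φ x ≤ C / T * a t ^ p⁻¹ * φ x ^ p⁻¹ :=
        mul_le_mul h1 (hself _ (hφ0 x) (hφ1 x)) (hφ0 x)
          (mul_nonneg (by positivity) (Real.rpow_nonneg (ha0 t) _))
      refine (mul_le_mul_of_nonneg_left h2 (abs_nonneg _)).trans (le_of_eq ?_)
      ring)
  rw [integral_indicator hmeas, setIntegral_const, smul_eq_mul, ← hV] at hI1
  -- The term with the sub-Laplacian.
  obtain ⟨h, hhi, hh0, hhS, hhv⟩ := exists_annuli_bound G L
  have hI2 := abs_setIntegral_le hpq (u := fun z => u z.1 z.2) (ψ := fun z => a z.1 * φ z.2)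
    (F := fun z => u z.1 z.2 * Lap (fun x => a z.1 * φ x) z.2) (S := S) (T := 2 * T)
    (by positivity) hψ hψS (hu.integrable _ htest)
    (c := fun x => K / L * G.gauge x ^ (-2 / (G.gaugeDeg : ℝ)))
    (h := fun x => (2 * (K / L)) ^ q * h x)
    (fun x => mul_nonneg (by positivity) (Real.rpow_nonneg (G.gauge_nonneg x) _))
    (hhi.const_mul _) (fun x => mul_nonneg (by positivity) (hh0 x))
    (fun x hx => by
      rw [← mul_assoc, Real.mul_rpow (by positivity) (Real.rpow_nonneg (G.gauge_nonneg x) _),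
        ← Real.rpow_mul (G.gauge_nonneg x)]
      refine mul_le_mul_of_nonneg_left ?_ (by positivity)
      have hexp : -2 / (G.gaugeDeg : ℝ) * q = -((G.homDim : ℝ) / G.gaugeDeg) := by
        rw [← hq]
        ring
      rw [hexp]
      exact hhS x hx.1 hx.2)
    (fun t x _ hx => by
      simp only
      rw [abs_mul, hLmul _ _ hφs, abs_of_nonneg (ha0 t), Real.mul_rpow (ha0 t) (hφ0 x)]
      have h2 : a t * |Lap φ x| ≤ a t ^ p⁻¹
          * (K / L * φ x ^ p⁻¹ * G.gauge x ^ (-2 / (G.gaugeDeg : ℝ))) :=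
        mul_le_mul (hself _ (ha0 t) (ha1 t)) (hK L hL1 x hx) (abs_nonneg _)
          (Real.rpow_nonneg (ha0 t) _)
      refine (mul_le_mul_of_nonneg_left h2 (abs_nonneg _)).trans (le_of_eq ?_)
      ring)
  rw [integral_const_mul] at hI2
  -- The initial datum and the source.
  have hI0 : 0 ≤ ∫ x in ({0}ᶜ : Set (Fin n → ℝ)), u₀ x * (a 0 * φ x) :=
    integral_nonneg_of_ae ((ae_restrict_of_ae hu₀).mono fun x hx =>
      mul_nonneg hx (mul_nonneg (ha0 0) (hφ0 x)))
  have hIf : T * ε ≤ ∫ z in Ioi (0 : ℝ) ×ˢ ({0}ᶜ : Set (Fin n → ℝ)),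
      f z.2 * (a z.1 * φ z.2) := by
    have h1 : (fun z : ℝ × (Fin n → ℝ) => f z.2 * (a z.1 * φ z.2))
        = fun z => a z.1 * (f z.2 * φ z.2) := by
      ext z
      ring
    rw [h1, Measure.volume_eq_prod, setIntegral_prod_mul a fun x => f x * φ x]
    refine mul_le_mul ?_ hεf hε (setIntegral_nonneg measurableSet_Ioi fun t _ => ha0 t)
    have hai : Integrable a := has.continuous.integrable_of_hasCompactSupport hac
    calc T = ∫ t in Ioc 0 T, (1 : ℝ) := by simp [hT0.le]
      _ = ∫ t in Ioc 0 T, a t := by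
        refine setIntegral_congr_fun measurableSet_Ioc fun t ht => (hb1 _ ?_).symm
        rw [abs_of_nonneg (by have := ht.1; positivity)]
        exact (div_le_one hT0).2 ht.2
      _ ≤ ∫ t in Ioi 0, a t :=
        setIntegral_mono_set hai.integrableOn (Filter.Eventually.of_forall ha0)
          (Filter.Eventually.of_forall Ioc_subset_Ioi_self)
  have heq := hu.weak_eq _ htest
  have hhv' := mul_le_mul_of_nonneg_left hhv
    (by positivity : (0 : ℝ) ≤ (2 * (K / L)) ^ q)
  have b1 := neg_abs_le (∫ z in Ioi (0 : ℝ) ×ˢ ({0}ᶜ : Set (Fin n → ℝ)),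
    u z.1 z.2 * deriv (fun s => a s * φ z.2) z.1)
  have b2 := neg_abs_le (∫ z in Ioi (0 : ℝ) ×ˢ ({0}ᶜ : Set (Fin n → ℝ)),
    u z.1 z.2 * Lap (fun x => a z.1 * φ x) z.2)
  have hfin : T * ε ≤ T * (V * (2 * (C / T)) ^ q) + T * ((2 * (K / L)) ^ q * ∫ x, h x) := by
    linarith
  rw [← mul_add] at hfin
  have := le_of_mul_le_mul_left hfin hT0
  linarith

/-- The nonexistence for any operator that agrees with the sub-Laplacian up to sign. -/
lemma not_isGlobalWeakSolution {n m : ℕ} (G : StratifiedGroup n)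
    (X : Module.Basis (Fin m) ℝ G.firstStratum)
    (hQ : 2 < G.homDim) (p : ℝ) (hp : p = (G.homDim : ℝ) / ((G.homDim : ℝ) - 2))
    (f u₀ : (Fin n → ℝ) → ℝ)
    (hf : LocallyIntegrable f volume)
    (hu₀ : ∀ᵐ x ∂(volume : Measure (Fin n → ℝ)), 0 ≤ u₀ x)
    (hf_pos : ∫⁻ x in ({0}ᶜ : Set (Fin n → ℝ)), ENNReal.ofReal (-f x)
      < ∫⁻ x in ({0}ᶜ : Set (Fin n → ℝ)), ENNReal.ofReal (f x))
    {Lap : ((Fin n → ℝ) → ℝ) → (Fin n → ℝ) → ℝ}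
    (hLap : ∀ φ x, |Lap φ x| = |subLaplacian G X φ x|) {u : ℝ → (Fin n → ℝ) → ℝ} :
    ¬ IsGlobalWeakSolution Lap p f u₀ u := by
  intro hu
  have hQ' : (2 : ℝ) < G.homDim := by exact_mod_cast hQ
  set Q : ℝ := (G.homDim : ℝ) with hQdef
  have hpi : p⁻¹ = (Q - 2) / Q := by rw [hp, inv_div]
  have hpq : p.HolderConjugate (Q / 2) := by
    rw [Real.holderConjugate_iff]
    refine ⟨?_, ?_⟩
    · rw [hp, lt_div_iff₀ (by linarith)]
      linarith
    · rw [hpi, inv_div]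
      field_simp
      ring
  obtain ⟨b, hb, hnn, hle, hb1, hb0, C, hC0, hC⟩ := exists_cutoff hQ
  rw [← hQdef, ← hpi] at hC
  obtain ⟨K, hK0, hK⟩ := exists_bound_subLaplacian G X hb hnn hb0 hC0 (fun s => (hC s).1)
    fun s => (hC s).2
  have hgc : ∀ k : ℕ, 1 ≤ k → Continuous fun x => logCut b k (G.gauge x) := fun k hk =>
    (contDiff_logCut_gauge G.toHomogeneousGroup hb hb0 (by positivity)).continuous
  have hbm : ∀ k : ℕ, Measurable fun x => logCut b k (G.gauge x) := fun k => by
    have h1 : Measurable (logCut b k) :=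
      Measurable.ite measurableSet_Iic measurable_const
        (hb.continuous.measurable.comp (Real.measurable_log.div_const _))
    exact h1.comp G.contDiff_gauge.continuous.measurable
  obtain ⟨ε, hε, hev⟩ := exists_pos_eventually_le_integral_mul
    (μ := volume.restrict ({0}ᶜ : Set (Fin n → ℝ))) (f := f)
    hf.aestronglyMeasurable.restrict hf_pos hbm
    (fun k x => logCut_nonneg hnn _ _) (fun k x => logCut_le_one hle _ _)
    ((ae_restrict_iff' (measurableSet_singleton _).compl).2 (Filter.Eventually.of_forall
      fun x hx => tendsto_logCut_gauge G.toHomogeneousGroup hb1 hx)) (by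
      filter_upwards [Filter.eventually_ge_atTop 1] with k hk
      have h := hf.integrable_smul_right_of_hasCompactSupport (hgc k hk)
        (hasCompactSupport_logCut_gauge G.toHomogeneousGroup hb0 (by positivity))
      exact h.integrableOn)
  set W := Real.exp (Q / G.gaugeDeg) * volume.real {x | G.gauge x ≤ 1} with hW
  have hW0 : 0 ≤ W := by positivity
  have hq1 : 1 < Q / 2 := hpq.symm.lt
  -- Let `T → ∞`.
  have hstep : ∀ᶠ k : ℕ in Filter.atTop,
      ε ≤ (2 * (K / k)) ^ (Q / 2) * ((4 * k + 1) * W) := by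
    filter_upwards [hev, Filter.eventually_ge_atTop 1] with k hk hk1
    have hlim : Filter.Tendsto (fun T : ℝ => (2 * (C / T)) ^ (Q / 2)
        * volume.real {x | G.gauge x ≤ Real.exp (2 * k)}
        + (2 * (K / k)) ^ (Q / 2) * ((4 * k + 1) * W)) Filter.atTop
        (nhds (0 + (2 * (K / k)) ^ (Q / 2) * ((4 * k + 1) * W))) := by
      refine Filter.Tendsto.add_const _ ?_
      have h1 : Filter.Tendsto (fun T : ℝ => 2 * (C / T)) Filter.atTop (nhds 0) := by
        simpa using (Filter.Tendsto.const_div_atTop Filter.tendsto_id C).const_mul 2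
      have h2 := h1.rpow_const (p := Q / 2) (Or.inr (by linarith))
      rw [Real.zero_rpow (by linarith)] at h2
      simpa using h2.mul_const (volume.real {x | G.gauge x ≤ Real.exp (2 * k)})
    rw [zero_add] at hlim
    refine ge_of_tendsto hlim ?_
    filter_upwards [Filter.eventually_ge_atTop 1] with T hT
    refine integral_source_mul_cutoff_le G.toHomogeneousGroup hpq (by rw [← hQdef]; ring) hu₀ hu
      hb hnn hle hb1 hb0 hC0 (fun s => (hC s).1) hK0 ?_ ?_ hk1 hT hε.le hk
    · intro c φ hφ x
      rw [hLap, hLap, subLaplacian_const_mul G X c hφ, abs_mul]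
    · intro L hL x hx
      rw [hLap]
      exact hK L hL x hx
  -- Let `L → ∞`: the energy of the cutoff is of order `L ^ (1 - Q / 2)`.
  have hlim : Filter.Tendsto (fun k : ℕ => (2 * K) ^ (Q / 2) * (5 * W) * (k : ℝ) ^ (-(Q / 2 - 1)))
      Filter.atTop (nhds ((2 * K) ^ (Q / 2) * (5 * W) * 0)) :=
    ((tendsto_rpow_neg_atTop (by linarith)).comp tendsto_natCast_atTop_atTop).const_mul _
  rw [mul_zero] at hlim
  refine hε.not_ge (ge_of_tendsto hlim ?_)
  filter_upwards [hstep, Filter.eventually_ge_atTop 1] with k hk hk1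
  have hk1' : (1 : ℝ) ≤ k := by exact_mod_cast hk1
  have hk0 : (0 : ℝ) < k := by linarith
  refine hk.trans ?_
  calc (2 * (K / k)) ^ (Q / 2) * ((4 * k + 1) * W)
      ≤ (2 * (K / k)) ^ (Q / 2) * ((5 * k) * W) := by
        gcongr
        linarith
    _ = (2 * K) ^ (Q / 2) * (5 * W) * (k : ℝ) ^ (-(Q / 2 - 1)) := by
        rw [← mul_div_assoc, Real.div_rpow (by positivity) hk0.le, neg_sub,
          Real.rpow_sub hk0, Real.rpow_one]
        ring

end Stratified

/-- The integral of `f` is positive: `∫ f⁻ < ∫ f⁺` in `[0, ∞]`, so `f⁻` is integrable and `f` has an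
integral in `(0, ∞]`; for `f ≥ 0` this says `0 < ∫ f ≤ ∞`. The result is stated for both sign
conventions of the sub-Laplacian. -/
theorem mainTheorem2 {n m : ℕ} (G : Stratified.StratifiedGroup n)
    (X : Module.Basis (Fin m) ℝ G.firstStratum)
    (hQ : 2 < G.homDim) (p : ℝ) (hp : p = (G.homDim : ℝ) / ((G.homDim : ℝ) - 2))
    (f u₀ : (Fin n → ℝ) → ℝ)
    (hf : LocallyIntegrable f volume) (hu₀ : LocallyIntegrable u₀ volume)
    (hu₀_nonneg : ∀ᵐ x ∂(volume : Measure (Fin n → ℝ)), 0 ≤ u₀ x)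
    (hf_pos : ∫⁻ x in ({0}ᶜ : Set (Fin n → ℝ)), ENNReal.ofReal (-f x)
      < ∫⁻ x in ({0}ᶜ : Set (Fin n → ℝ)), ENNReal.ofReal (f x)) :
    (¬ ∃ u : ℝ → (Fin n → ℝ) → ℝ,
      Stratified.IsGlobalWeakSolution (Stratified.subLaplacian G X) p f u₀ u) ∧
    (¬ ∃ u : ℝ → (Fin n → ℝ) → ℝ,
      Stratified.IsGlobalWeakSolution (fun φ x => -Stratified.subLaplacian G X φ x) p f u₀ u) := by
  refine ⟨?_, ?_⟩ <;> rintro ⟨u, hu⟩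
  · exact Stratified.not_isGlobalWeakSolution G X hQ p hp f u₀ hf hu₀_nonneg hf_pos
      (fun _ _ => rfl) hu
  · exact Stratified.not_isGlobalWeakSolution G X hQ p hp f u₀ hf hu₀_nonneg hf_pos
      (fun _ _ => abs_neg _) hu
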